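/- Let $G$ be a finite weighted undirected multigraph with vertex set $V(G)=\{1,\dots,n\}$, $n\ge 1$, in which every edge carries a real weight (negative weights are allowed). Let $L=L(G)=(\ell_{ij})$ be its Kirchhoff matrix: for $j\ne i$, $-\ell_{ij}$ is the sum of the weights of all edges between $i$ and $j$, and $\ell_{ii}=-\sum_{j\neq i}\ell_{ij}$. Let $W=I+L$, and let $W^{ij}$ be the cofactor of the $(i,j)$-entry of $W$, that is, $(-1)^{i+j}$ times the determinant of $W$ with row $i$ and column $j$ deleted. A spanning rooted forest of $G$ is a spanning subgraph of $G$ without cycles (a loop or a pair of parallel edges counts as a cycle), together with a choice of exactly one vertex, the root, in each of its connected components. Its weight is the product of the weights of its edges (equal to $1$ if it has no edges), and the weight $\varepsilon(\mathcal S)$ of a finite set $\mathcal S$ of rooted forests is the sum of the weights of its elements (equal to $0$ if $\mathcal S$ is empty). For $i,j\in V(G)$ let $\mathcal F^{ij}$ be the set of those spanning rooted forests of $G$ in which $i$ and $j$ belong to the same tree (component) and the root of this tree is $i$. Then for all $i,j\in V(G)$ the set $\mathcal F^{ij}$ is finite and $$W^{ij}=\varepsilon(\mathcal F^{ij}).$$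 In particular, if all edge weights are equal to $1$, then $W^{ij}$ is the number of elements of $\mathcal F^{ij}$. -/

import Mathlib

noncomputable section

namespace Graph

variable {α β : Type*}

/-- Two vertices are joined in `G` if one can pass from one to the other along edges of `G`. -/
def Joined (G : Graph α β) (x y : α) : Prop :=
  Relation.ReflTransGen G.Adj x y

/-- A multigraph is connected if it has a vertex and any two of its vertices are joined. -/
def IsConnected (G : Graph α β) : Prop :=
  G.vertexSet.Nonempty ∧ ∀ x ∈ G.vertexSet, ∀ y ∈ G.vertexSet, G.Joined x y

/-- A component of `G` is a maximal (by inclusion) connected subgraph of `G`. -/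
def IsComponent (G K : Graph α β) : Prop :=
  Maximal (fun K' : Graph α β => K' ≤ G ∧ K'.IsConnected) K

/-- `G` contains a cycle: there are `m ≥ 1`, distinct vertices `v 0, …, v (m - 1)` and distinct
edges `e 0, …, e (m - 1)` such that `e k` joins `v k` and `v (k + 1)`, where `v m = v 0`.
For `m = 1` this is a loop, for `m = 2` a pair of parallel edges. -/
def HasCycle (G : Graph α β) : Prop :=
  ∃ (m : ℕ) (v : ℕ → α) (e : ℕ → β), 0 < m ∧ Set.InjOn v (Set.Iio m) ∧
    Set.InjOn e (Set.Iio m) ∧ v m = v 0 ∧ ∀ k < m, G.IsLink (e k) (v k) (v (k + 1))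

/-- A forest is a multigraph without cycles. -/
def IsForest (G : Graph α β) : Prop :=
  ¬ G.HasCycle

/-- A rooted forest: a forest `F` with a set `R` of marked vertices (the roots) which has exactly
one element in each component of `F`. -/
structure IsRootedForest (F : Graph α β) (R : Set α) : Prop where
  isForest : F.IsForest
  roots_subset : R ⊆ F.vertexSet
  existsUnique_root : ∀ K : Graph α β, F.IsComponent K → ∃! r, r ∈ R ∧ r ∈ K.vertexSet

/-- The spanning rooted forests of `G`, as pairs (forest, set of roots). -/
def spanningRootedForests (G : Graph α β) : Set (Graph α β × Set α) :=
  {F | F.1.IsSpanningSubgraph G ∧ F.1.IsRootedForest F.2}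

/-- The spanning rooted forests of `G` in which `i` and `j` belong to the same tree
(component), this tree having the root `i`. -/
def spanningRootedForestsAt (G : Graph α β) (i j : α) : Set (Graph α β × Set α) :=
  {F | F ∈ G.spanningRootedForests ∧
    ∃ T : Graph α β, F.1.IsComponent T ∧ i ∈ T.vertexSet ∧ j ∈ T.vertexSet ∧ i ∈ F.2}

/-- The weight of a (sub)graph: the product of the weights of its edges. -/
def weight (w : β → ℝ) (H : Graph α β) : ℝ :=
  ∏ᶠ e ∈ H.edgeSet, w e

/-- The weight of a set of rooted graphs: the sum of the weights of its elements. -/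
def totalWeight (w : β → ℝ) (S : Set (Graph α β × Set α)) : ℝ :=
  ∑ᶠ F ∈ S, F.1.weight w

/-- The total weight of the edges of `G` between `i` and `j`. -/
def linkWeight (G : Graph α β) (w : β → ℝ) (i j : α) : ℝ :=
  ∑ᶠ e ∈ {e | G.IsLink e i j}, w e

/-- The Kirchhoff (Laplacian) matrix of `G` with edge weights `w`. -/
def kirchhoffMatrix [Fintype α] [DecidableEq α] (G : Graph α β) (w : β → ℝ) : Matrix α α ℝ :=
  Matrix.of fun i j =>
    if i = j then ∑ k ∈ Finset.univ.erase i, G.linkWeight w i k else -G.linkWeight w i j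

/-- The matrix `W = I + L`. -/
def forestMatrix [Fintype α] [DecidableEq α] (G : Graph α β) (w : β → ℝ) : Matrix α α ℝ :=
  1 + G.kirchhoffMatrix w

end Graph

/-- The cofactor of the `(i, j)` entry of a square matrix: the determinant of the matrix with row
`i` and column `j` deleted, times `(-1) ^ (i + j)`. -/
def matrixCofactor {n : ℕ} (A : Matrix (Fin (n + 1)) (Fin (n + 1)) ℝ) (i j : Fin (n + 1)) : ℝ :=
  (-1) ^ ((i : ℕ) + (j : ℕ)) * (A.submatrix i.succAbove j.succAbove).det

end

/-! The cofactor is the determinant of `W` with row `i` replaced by the unit vector of `j`. Row `u`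
of `W` is the unit vector of `u` (from `I`) plus, for each non-loop edge `e` at `u`, the weight of
`e` times the difference of the unit vectors of `u` and of the other end of `e`. Multilinearity in
the rows gives a sum over all ways to give each `u ≠ i` no edge (`u` is a root) or one parent edge
(`adjugate_forestMatrix_eq_sum`).

Each term is the product of the chosen weights and a cofactor of the matrix of a functional digraph.
By `adjugate_arcMatrix` this cofactor is 1 if every vertex has a root as an ancestor and `i` is an
ancestor of `j`, and 0 otherwise, so cyclic choices drop out without any cancellation between terms.

The surviving choices orient the edges of a rooted forest towards its roots, and each rooted forest
has exactly one such orientation (`bijOn_choiceForest`). A parent edge belongs to only one vertex,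
so weights agree. -/

/-! ### Determinants and cofactors of functional digraphs -/

section FunctionalDigraph

open Matrix

variable {α : Type*} [Fintype α] [DecidableEq α]

/-- The matrix of a functional digraph: a vertex `u` outside `r` has the row
`e u - e (p u)`, a vertex `u` in `r` has the row `e u`. -/
def arcMatrix (p : α → α) (r : α → Prop) [DecidablePred r] : Matrix α α ℝ :=
  Matrix.of fun u => Pi.single u 1 - if r u then 0 else Pi.single (p u) 1

variable (p : α → α) (r : α → Prop) [DecidablePred r]

lemma arcMatrix_mulVec (x : α → ℝ) (u : α) :
    (arcMatrix p r *ᵥ x) u = x u - if r u then 0 else x (p u) := by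
  simp only [Matrix.mulVec, arcMatrix]
  change (Pi.single u 1 - if r u then 0 else Pi.single (p u) 1) ⬝ᵥ x = _
  rw [sub_dotProduct]
  split_ifs <;> simp

/-- Outside `r`, the map `p` lowers the number of steps needed to reach `r`. Ordered by this number,
the matrix is block triangular with identity diagonal blocks. -/
lemma det_arcMatrix_of_forall_exists (h : ∀ u, ∃ k, r (p^[k] u)) : (arcMatrix p r).det = 1 := by
  set d : α → ℕ := fun u => Nat.find (h u) with hd
  have hlt : ∀ u, ¬ r u → d (p u) < d u := by
    intro u hu
    have h0 : d u ≠ 0 := by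
      intro h0
      have := Nat.find_spec (h u)
      rw [show Nat.find (h u) = 0 from h0] at this
      exact hu this
    obtain ⟨k, hk⟩ := Nat.exists_eq_succ_of_ne_zero h0
    have hs := Nat.find_spec (h u)
    rw [show Nat.find (h u) = k + 1 from hk, Function.iterate_succ_apply] at hs
    have : d (p u) ≤ k := Nat.find_min' (h (p u)) hs
    omega
  have hB : (arcMatrix p r).BlockTriangular (OrderDual.toDual ∘ d) := by
    intro u v huv
    have huv' : d u < d v := huv
    have h1 : v ≠ u := by rintro rfl; exact lt_irrefl _ huv'
    simp only [arcMatrix, Matrix.of_apply, Pi.sub_apply, Pi.single_apply, if_neg h1]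
    split_ifs with hr
    · simp
    · have : v ≠ p u := by rintro rfl; exact lt_asymm huv' (hlt u hr)
      simp [this]
  rw [hB.det]
  refine Finset.prod_eq_one fun a _ => ?_
  convert Matrix.det_one (n := {u // (OrderDual.toDual ∘ d) u = a}) (R := ℝ)
  ext ⟨u, hu⟩ ⟨v, hv⟩
  have huv : d u = d v := OrderDual.toDual.injective (hu.trans hv.symm)
  simp only [toSquareBlock_def, arcMatrix, Matrix.of_apply, Pi.sub_apply, Pi.single_apply,
    Matrix.one_apply, Subtype.mk.injEq]
  have h2 : (if r u then (0 : α → ℝ) else Pi.single (p u) 1) v = 0 := by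
    split_ifs with hr
    · rfl
    · have : v ≠ p u := by rintro rfl; exact (hlt u hr).ne' huv
      simp [this]
  rw [h2]
  simp [eq_comm]

/-- The indicator of the vertices that never reach `r` vanishes on `r` and is constant along `p`
outside `r`, so it is a nonzero kernel vector. -/
lemma det_arcMatrix_of_not_forall (h : ¬ ∀ u, ∃ k, r (p^[k] u)) : (arcMatrix p r).det = 0 := by
  classical
  rw [← Matrix.exists_mulVec_eq_zero_iff]
  push Not at h
  obtain ⟨u₀, hu₀⟩ := h
  refine ⟨fun u => if ∀ k, ¬ r (p^[k] u) then 1 else 0, fun h0 => ?_, ?_⟩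
  · have := congrFun h0 u₀
    simp [hu₀] at this
  · ext u
    rw [arcMatrix_mulVec]
    by_cases hr : r u
    · have : ¬ ∀ k, ¬ r (p^[k] u) := fun h => h 0 hr
      simp [hr, this]
    · have : (∀ k, ¬ r (p^[k] u)) ↔ ∀ k, ¬ r (p^[k] (p u)) := by
        refine ⟨fun h k => ?_, fun h k => ?_⟩
        · rw [← Function.iterate_succ_apply]; exact h _
        · cases k with
          | zero => exact hr
          | succ k => rw [Function.iterate_succ_apply]; exact h k
      simp only [hr, this, if_false, sub_self, Pi.zero_apply]

open Classical in
lemma arcMatrix_mulVec_indicator {i : α}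
    (hp : ∀ u, r u → p u = u) (hi : r i) :
    arcMatrix p r *ᵥ (fun u => if ∃ k, p^[k] u = i then (1 : ℝ) else 0) = Pi.single i 1 := by
  ext u
  rw [arcMatrix_mulVec]
  by_cases hr : r u
  · have h1 : (∃ k, p^[k] u = i) ↔ u = i :=
      ⟨fun ⟨k, hk⟩ => by rwa [Function.iterate_fixed (hp u hr)] at hk, fun h => ⟨0, h⟩⟩
    simp [hr, h1, Pi.single_apply]
  · have hui : u ≠ i := by rintro rfl; exact hr hi
    have h1 : (∃ k, p^[k] u = i) ↔ ∃ k, p^[k] (p u) = i := by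
      refine ⟨fun ⟨k, hk⟩ => ?_, fun ⟨k, hk⟩ => ⟨k + 1, hk⟩⟩
      cases k with
      | zero => exact absurd hk hui
      | succ k => exact ⟨k, hk⟩
    simp only [hr, h1, if_false, sub_self]
    simp [hui]

open Classical in
/-- The cofactors of the matrix of a functional digraph detect whether all vertices reach a root
and `j` reaches the root `i`. -/
lemma adjugate_arcMatrix {i : α} (j : α) (hp : ∀ u, r u → p u = u) (hi : r i) :
    (arcMatrix p r).adjugate j i =
      if (∀ u, ∃ k, r (p^[k] u)) ∧ ∃ k, p^[k] j = i then 1 else 0 := by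
  -- Applying the adjugate to `A x = e i` turns it into `det A • x`, so column `i` of the adjugate
  -- is `det A` times the indicator `x`.
  have h := congrArg ((arcMatrix p r).adjugate *ᵥ ·) (arcMatrix_mulVec_indicator p r hp hi)
  simp only [Matrix.mulVec_mulVec, Matrix.adjugate_mul, Matrix.mulVec_single_one,
    Matrix.smul_mulVec, Matrix.one_mulVec] at h
  have hj := congrFun h j
  simp only [Pi.smul_apply, smul_eq_mul, Matrix.col_apply] at hj
  rw [← hj]
  by_cases h1 : ∀ u, ∃ k, r (p^[k] u)
  · simp [det_arcMatrix_of_forall_exists p r h1, h1]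
  · simp [det_arcMatrix_of_not_forall p r h1, h1]

end FunctionalDigraph

lemma matrixCofactor_eq_adjugate {n : ℕ} (A : Matrix (Fin (n + 1)) (Fin (n + 1)) ℝ)
    (i j : Fin (n + 1)) : matrixCofactor A i j = A.adjugate j i := by
  rw [matrixCofactor, Matrix.adjugate_fin_succ_eq_det_submatrix]

namespace Graph

/-! ### Components of a multigraph -/

section Components

variable {α β : Type*} {G H K : Graph α β} {x y z : α}

lemma Joined.symm (h : G.Joined x y) : G.Joined y x :=
  (inferInstance : Std.Symm (Relation.ReflTransGen G.Adj)).symm _ _ h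

lemma Joined.trans (h : G.Joined x y) (h' : G.Joined y z) : G.Joined x z :=
  Relation.ReflTransGen.trans h h'

lemma Joined.mono (hHG : H ≤ G) (h : H.Joined x y) : G.Joined x y :=
  Relation.ReflTransGen.mono (fun _ _ h => Adj.mono hHG h) _ _ h

lemma Joined.mem (h : G.Joined x y) (hx : x ∈ G.vertexSet) : y ∈ G.vertexSet := by
  induction h with
  | refl => exact hx
  | tail _ h _ => exact h.right_mem

/-- The subgraph induced on the vertices joined to `x`. -/
def component (G : Graph α β) (x : α) : Graph α β := G.induce {y | G.Joined x y}

lemma component_le (hx : x ∈ G.vertexSet) : G.component x ≤ G :=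
  induce_le fun _ hy => Joined.mem hy hx

lemma Joined.component (h : G.Joined x y) : (G.component x).Joined x y := by
  induction h with
  | refl => exact Relation.ReflTransGen.refl
  | @tail b c hb hbc ih =>
    obtain ⟨e, he⟩ := hbc
    refine ih.tail ⟨e, ?_⟩
    simp only [Graph.component, induce_isLink]
    exact ⟨he, hb, hb.tail ⟨e, he⟩⟩

lemma component_isConnected : (G.component x).IsConnected :=
  ⟨⟨x, Relation.ReflTransGen.refl⟩, fun _ hy _ hz =>
    (Joined.component hy).symm.trans (Joined.component hz)⟩

lemma le_component (hK : K ≤ G) (hc : K.IsConnected) (hx : x ∈ K.vertexSet) :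
    K ≤ G.component x := by
  have hV : ∀ y ∈ K.vertexSet, G.Joined x y := fun y hy => (hc.2 x hx y hy).mono hK
  refine ⟨hV, fun e y z h => ?_⟩
  simp only [Graph.component, induce_isLink]
  exact ⟨h.mono hK, hV y h.left_mem, hV z h.right_mem⟩

lemma isComponent_component (hx : x ∈ G.vertexSet) : G.IsComponent (G.component x) :=
  ⟨⟨component_le hx, component_isConnected⟩, fun _ hK hle =>
    le_component hK.1 hK.2 (hle.vertexSet_mono Relation.ReflTransGen.refl)⟩

lemma IsComponent.eq_component (hK : G.IsComponent K) (hx : x ∈ K.vertexSet) :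
    K = G.component x := by
  have hle := le_component hK.1.1 hK.1.2 hx
  exact hle.antisymm (hK.2 ⟨component_le (hK.1.1.vertexSet_mono hx), component_isConnected⟩ hle)

lemma IsComponent.mem_iff (hK : G.IsComponent K) (hx : x ∈ K.vertexSet) :
    y ∈ K.vertexSet ↔ G.Joined x y := by
  rw [hK.eq_component hx]; rfl

end Components

/-! ### Cycles from non-backtracking walks -/

section Cycles

variable {α β : Type*} {G : Graph α β}

/-- A non-backtracking walk that visits some vertex twice yields a cycle. -/
lemma hasCycle_of_walk {m : ℕ} {v : ℕ → α} {e : ℕ → β}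
    (hlink : ∀ k < m, G.IsLink (e k) (v k) (v (k + 1)))
    (hne : ∀ k, k + 1 < m → e k ≠ e (k + 1))
    {s t : ℕ} (hst : s < t) (htm : t ≤ m) (hv : v s = v t) : G.HasCycle := by
  classical
  -- At the least time `t` of a repetition, the vertices before `t` are distinct.
  have hex : ∃ t, t ≤ m ∧ ∃ s < t, v s = v t := ⟨t, htm, s, hst, hv⟩
  obtain ⟨htm, s, hst, hv⟩ := Nat.find_spec hex
  have hmin := fun t => @Nat.find_min _ _ hex t
  generalize Nat.find hex = t at *
  have hinj : ∀ a b, a < b → b < t → v a ≠ v b := fun a b hab hbt h =>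
    hmin b hbt ⟨hbt.le.trans htm, a, hab, h⟩
  -- If `e a = e b`, then `v b` is `v a` or `v (a + 1)`. Distinctness leaves only `b = a + 1`, which
  -- is backtracking.
  have hinjE : ∀ a b, a < b → b < t → s ≤ a → e a ≠ e b := by
    intro a b hab hbt hsa h
    have ha := hlink a (by omega)
    have hb := hlink b (by omega)
    rw [← h] at hb
    rcases hb.left_eq_or_eq ha with h1 | h1
    · exact hinj a b hab hbt h1.symm
    · rcases Nat.lt_or_ge (a + 1) b with h2 | h2
      · exact hinj _ b h2 hbt h1.symm
      · obtain rfl : b = a + 1 := by omega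
        exact hne a (by omega) h
  refine ⟨t - s, fun k => v (s + k), fun k => e (s + k), by omega, ?_, ?_, ?_, ?_⟩
  · intro a ha b hb h
    simp only [Set.mem_Iio] at ha hb
    rcases lt_trichotomy a b with h1 | h1 | h1
    · exact absurd h (hinj _ _ (by omega) (by omega))
    · exact h1
    · exact absurd h.symm (hinj _ _ (by omega) (by omega))
  · intro a ha b hb h
    simp only [Set.mem_Iio] at ha hb
    rcases lt_trichotomy a b with h1 | h1 | h1
    · exact absurd h (hinjE _ _ (by omega) (by omega) (by omega))
    · exact h1
    · exact absurd h.symm (hinjE _ _ (by omega) (by omega) (by omega))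
  · simp only [Nat.add_zero]
    rw [show s + (t - s) = t by omega, hv]
  · intro k hk
    exact hlink (s + k) (by omega)

end Cycles

/-! ### Parent choices -/

section ParentChoice

variable {α β : Type*}

open Classical in
/-- The end other than `u` of an edge `e` at `u` (and `u` if `e` is not an edge at `u`). -/
noncomputable def otherEnd (G : Graph α β) (u : α) (e : β) : α :=
  if h : ∃ v, G.IsLink e u v then h.choose else u

/-- The parent of a vertex, for a choice of at most one edge at each vertex. -/
noncomputable def parent (G : Graph α β) (c : α → Option β) (u : α) : α :=
  (c u).elim u (G.otherEnd u)

/-- A choice of at most one edge (its parent edge) at each vertex, loops not allowed, such that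
every vertex has an ancestor without a parent edge. -/
structure IsParentChoice (G : Graph α β) (c : α → Option β) : Prop where
  isNonloopAt : ∀ u e, c u = some e → G.IsNonloopAt e u
  exists_root : ∀ u, ∃ k, c ((G.parent c)^[k] u) = none

variable {G : Graph α β} {c : α → Option β} {u v : α} {e : β}

lemma IsLink.otherEnd_eq (h : G.IsLink e u v) : G.otherEnd u e = v := by
  have h' : ∃ v, G.IsLink e u v := ⟨v, h⟩
  rw [otherEnd, dif_pos h']
  exact h'.choose_spec.right_unique h

lemma IsNonloopAt.isLink_otherEnd (h : G.IsNonloopAt e u) : G.IsLink e u (G.otherEnd u e) := by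
  obtain ⟨v, -, hv⟩ := h
  rwa [hv.otherEnd_eq]

lemma IsNonloopAt.otherEnd_ne (h : G.IsNonloopAt e u) : G.otherEnd u e ≠ u := by
  obtain ⟨v, hne, hv⟩ := h
  rwa [hv.otherEnd_eq]

lemma parent_of_eq_none (h : c u = none) : G.parent c u = u := by simp [parent, h]

lemma parent_of_eq_some (h : c u = some e) : G.parent c u = G.otherEnd u e := by simp [parent, h]

namespace IsParentChoice

variable (hc : G.IsParentChoice c)
include hc

lemma isLink_parent (h : c u = some e) : G.IsLink e u (G.parent c u) := by
  rw [parent_of_eq_some h]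
  exact (hc.isNonloopAt u e h).isLink_otherEnd

end IsParentChoice

end ParentChoice

end Graph

/-! ### From parent choices to rooted forests -/

namespace Graph

variable {α β : Type*} {G : Graph α β} {c : α → Option β} {u v : α} {e : β}

/-- The number of steps from a vertex to its last ancestor. -/
noncomputable def choiceDepth (G : Graph α β) (c : α → Option β) (u : α) : ℕ :=
  sInf {k | c ((G.parent c)^[k] u) = none}

/-- The last ancestor of a vertex. -/
noncomputable def choiceRoot (G : Graph α β) (c : α → Option β) (u : α) : α :=
  (G.parent c)^[G.choiceDepth c u] u

/-- The subgraph formed by the parent edges. -/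
def choiceForest (G : Graph α β) (c : α → Option β) : Graph α β :=
  G.restrict {e | ∃ u, c u = some e}

lemma choiceRoot_of_eq_none (h : c u = none) : G.choiceRoot c u = u :=
  Function.iterate_fixed (parent_of_eq_none h) _

namespace IsParentChoice

variable (hc : G.IsParentChoice c)
include hc

lemma apply_choiceRoot (u : α) : c (G.choiceRoot c u) = none :=
  Nat.sInf_mem (hc.exists_root u)

lemma choiceDepth_eq_succ (h : c u = some e) :
    G.choiceDepth c u = G.choiceDepth c (G.parent c u) + 1 := by
  have hu : c ((G.parent c)^[G.choiceDepth c u] u) = none := hc.apply_choiceRoot u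
  have h0 : G.choiceDepth c u ≠ 0 := by
    intro h0
    rw [h0] at hu
    simp [h] at hu
  obtain ⟨k, hk⟩ := Nat.exists_eq_succ_of_ne_zero h0
  refine le_antisymm (Nat.sInf_le ?_) ?_
  · exact Nat.sInf_mem (hc.exists_root (G.parent c u))
  · rw [hk]
    refine Nat.succ_le_succ (Nat.sInf_le ?_)
    rwa [hk] at hu

lemma choiceRoot_parent (u : α) : G.choiceRoot c (G.parent c u) = G.choiceRoot c u := by
  cases h : c u with
  | none => rw [parent_of_eq_none h]
  | some e =>
    rw [choiceRoot, choiceRoot, hc.choiceDepth_eq_succ h, Function.iterate_succ_apply]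

lemma choiceRoot_iterate (k : ℕ) (u : α) :
    G.choiceRoot c ((G.parent c)^[k] u) = G.choiceRoot c u := by
  induction k generalizing u with
  | zero => rfl
  | succ k ih => rw [Function.iterate_succ_apply, ih, hc.choiceRoot_parent]

lemma exists_iterate_eq_iff (hv : c v = none) :
    (∃ k, (G.parent c)^[k] u = v) ↔ G.choiceRoot c u = v := by
  refine ⟨?_, fun h => ⟨_, h⟩⟩
  rintro ⟨k, rfl⟩
  rw [← hc.choiceRoot_iterate k, choiceRoot_of_eq_none hv]

lemma parent_ne (h : c u = some e) : G.parent c u ≠ u := by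
  rw [parent_of_eq_some h]
  exact (hc.isNonloopAt u e h).otherEnd_ne

/-- Two different vertices sharing a parent edge would be parents of each other, while depth drops
by one from a vertex to its parent. -/
lemma eq_of_eq_some (hu : c u = some e) (hv : c v = some e) : u = v := by
  rcases (hc.isLink_parent hu).eq_and_eq_or_eq_and_eq (hc.isLink_parent hv) with h | ⟨h1, h2⟩
  · exact h.1
  · have h3 := hc.choiceDepth_eq_succ hu
    have h4 := hc.choiceDepth_eq_succ hv
    rw [← h1] at h4
    rw [h2] at h3
    omega

lemma choiceForest_isLink (h : c u = some e) : (G.choiceForest c).IsLink e u (G.parent c u) :=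
  ⟨⟨u, h⟩, hc.isLink_parent h⟩

lemma edgeSet_choiceForest : (G.choiceForest c).edgeSet = {e | ∃ u, c u = some e} := by
  ext e
  simp only [choiceForest, edgeSet_restrict, Set.mem_inter_iff, Set.mem_ofPred_eq,
    and_iff_right_iff_imp]
  rintro ⟨u, h⟩
  exact (hc.isLink_parent h).edge_mem

lemma eq_some_or_eq_some (h : (G.choiceForest c).IsLink e u v) :
    (c u = some e ∧ G.parent c u = v) ∨ (c v = some e ∧ G.parent c v = u) := by
  obtain ⟨⟨x, hx⟩, h⟩ := h
  rcases (hc.isLink_parent hx).eq_and_eq_or_eq_and_eq h with ⟨rfl, h2⟩ | ⟨rfl, h2⟩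
  · exact Or.inl ⟨hx, h2⟩
  · exact Or.inr ⟨hx, h2⟩

lemma eq_some_of_depth_le (h : (G.choiceForest c).IsLink e u v)
    (hd : G.choiceDepth c v ≤ G.choiceDepth c u) : c u = some e := by
  rcases hc.eq_some_or_eq_some h with h | ⟨h1, h2⟩
  · exact h.1
  · have := hc.choiceDepth_eq_succ h1
    rw [h2] at this
    omega

/-- At a deepest vertex of a cycle, both cycle edges would be its parent edge. They therefore
coincide, and the cycle is a loop, which is excluded. -/
lemma choiceForest_isForest : (G.choiceForest c).IsForest := by
  rintro ⟨m, v, e, hm, -, heinj, hvm, hlink⟩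
  obtain ⟨t, ht, hmax⟩ := Finset.exists_max_image (Finset.range m)
    (fun k => G.choiceDepth c (v (k + 1))) ⟨0, by simpa using hm⟩
  simp only [Finset.mem_range] at ht hmax
  have hmax' : ∀ k ≤ m, G.choiceDepth c (v k) ≤ G.choiceDepth c (v (t + 1)) := by
    intro k hk
    cases k with
    | zero =>
      rw [← hvm]
      obtain ⟨m, rfl⟩ := Nat.exists_eq_succ_of_ne_zero hm.ne'
      exact hmax m (by omega)
    | succ k => exact hmax k (by omega)
  have h1 : c (v (t + 1)) = some (e t) :=
    hc.eq_some_of_depth_le (hlink t ht).symm (hmax' t ht.le)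
  -- `s` is the index of the edge leaving the deepest vertex `v (t + 1)`; it wraps around to 0 if `t
  -- + 1 = m`.
  obtain ⟨s, hs, hvs, hst⟩ : ∃ s < m, v s = v (t + 1) ∧ (s = t → m = 1) := by
    rcases Nat.lt_or_ge (t + 1) m with h | h
    · exact ⟨t + 1, h, rfl, by omega⟩
    · obtain rfl : m = t + 1 := by omega
      exact ⟨0, by omega, hvm.symm, by omega⟩
  have h2 : c (v s) = some (e s) :=
    hc.eq_some_of_depth_le (hlink s hs) (by rw [hvs]; exact hmax' _ hs)
  rw [hvs, h1, Option.some_inj] at h2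
  obtain rfl := heinj ht hs h2
  obtain rfl := hst rfl
  obtain rfl : t = 0 := by omega
  have h3 := hlink 0 hm
  rw [hvm] at h3
  rcases hc.eq_some_or_eq_some h3 with h | h <;> exact hc.parent_ne h.1 h.2

lemma joined_parent (u : α) : (G.choiceForest c).Joined u (G.parent c u) := by
  cases h : c u with
  | none => rw [parent_of_eq_none h]; exact Relation.ReflTransGen.refl
  | some e => exact Relation.ReflTransGen.single ⟨e, hc.choiceForest_isLink h⟩

lemma joined_choiceRoot (u : α) : (G.choiceForest c).Joined u (G.choiceRoot c u) := by
  rw [choiceRoot]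
  generalize G.choiceDepth c u = k
  induction k with
  | zero => exact Relation.ReflTransGen.refl
  | succ k ih =>
    rw [Function.iterate_succ_apply']
    exact ih.trans (hc.joined_parent _)

lemma joined_iff : (G.choiceForest c).Joined u v ↔ G.choiceRoot c u = G.choiceRoot c v := by
  constructor
  · intro h
    induction h with
    | refl => rfl
    | tail _ h ih =>
      obtain ⟨e, h⟩ := h
      rw [ih]
      rcases hc.eq_some_or_eq_some h with ⟨-, h⟩ | ⟨-, h⟩
      · rw [← h, hc.choiceRoot_parent]
      · rw [← h, hc.choiceRoot_parent]
  · intro h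
    have := hc.joined_choiceRoot u
    rw [h] at this
    exact this.trans (hc.joined_choiceRoot v).symm

lemma isRootedForest (hV : G.vertexSet = Set.univ) :
    (G.choiceForest c).IsRootedForest {u | c u = none} where
  isForest := hc.choiceForest_isForest
  roots_subset := by
    change _ ⊆ G.vertexSet
    simp [hV]
  existsUnique_root K hK := by
    obtain ⟨x, hx⟩ := hK.1.2.1
    refine ⟨G.choiceRoot c x, ⟨hc.apply_choiceRoot x, (hK.mem_iff hx).2 (hc.joined_choiceRoot x)⟩,
      ?_⟩
    rintro r ⟨hr, hrK⟩
    rw [hc.joined_iff.1 ((hK.mem_iff hx).1 hrK), choiceRoot_of_eq_none hr]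

lemma mem_spanningRootedForests (hV : G.vertexSet = Set.univ) :
    (G.choiceForest c, {u | c u = none}) ∈ G.spanningRootedForests :=
  ⟨⟨restrict_le, rfl⟩, hc.isRootedForest hV⟩

/-- A parent choice is determined by its parent edges and its roots. -/
lemma ext_of_choiceForest {c' : α → Option β} (hc' : G.IsParentChoice c')
    (hF : G.choiceForest c = G.choiceForest c') (hR : {u | c u = none} = {u | c' u = none}) :
    c = c' := by
  have hR' : ∀ u, c u = none ↔ c' u = none := fun u => Set.ext_iff.1 hR u
  suffices h : ∀ d u, G.choiceDepth c u = d → c u = c' u from funext fun u => h _ u rfl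
  intro d
  induction d with
  | zero =>
    intro u hu
    cases h : c u with
    | none => rw [(hR' u).1 h]
    | some e => rw [hc.choiceDepth_eq_succ h] at hu; omega
  | succ d ih =>
    intro u hu
    cases h : c u with
    | none => rw [(hR' u).1 h]
    | some e =>
      have hd := hc.choiceDepth_eq_succ h
      have hl := hc.choiceForest_isLink h
      rw [hF] at hl
      rcases hc'.eq_some_or_eq_some hl with h1 | h1
      · exact h1.1.symm
      -- Here `c'` assigns `e` to the parent of `u`. By induction `c` does so too, and then `e` is
      -- the parent edge of two vertices.
      · have h2 := ih (G.parent c u) (by omega)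
        rw [h1.1] at h2
        exact absurd (hc.eq_of_eq_some h2 h) (hc.parent_ne h)

end IsParentChoice

/-! ### From rooted forests to parent choices -/

section Existence

/-- `x` is joined to `R` by a walk of length `n`. -/
def ReachesIn (F : Graph α β) (R : Set α) : ℕ → α → Prop
  | 0, x => x ∈ R
  | n + 1, x => ∃ e y, F.IsLink e x y ∧ ReachesIn F R n y

variable {F : Graph α β} {R : Set α} {x y : α}

lemma Joined.exists_reachesIn (h : F.Joined x y) (hy : y ∈ R) : ∃ n, F.ReachesIn R n x := by
  induction h using Relation.ReflTransGen.head_induction_on with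
  | refl => exact ⟨0, hy⟩
  | head h _ ih =>
    obtain ⟨n, hn⟩ := ih
    obtain ⟨e, he⟩ := h
    exact ⟨n + 1, e, _, he, hn⟩

lemma exists_shorter (h : ∀ x, ∃ n, F.ReachesIn R n x) (hx : x ∉ R) :
    ∃ e y, F.IsLink e x y ∧ sInf {n | F.ReachesIn R n y} < sInf {n | F.ReachesIn R n x} := by
  have hs : F.ReachesIn R (sInf {n | F.ReachesIn R n x}) x := Nat.sInf_mem (h x)
  cases hd : sInf {n | F.ReachesIn R n x} with
  | zero => exact absurd (by rwa [hd] at hs) hx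
  | succ n =>
    rw [hd] at hs
    obtain ⟨e, y, he, hy⟩ := hs
    exact ⟨e, y, he, Nat.lt_succ_of_le (Nat.sInf_le hy)⟩

/-- The edges that are first in a shortest path to `R`. -/
lemma exists_isParentChoice (hFG : F ≤ G) (h : ∀ x, ∃ n, F.ReachesIn R n x) :
    ∃ c, G.IsParentChoice c ∧ (∀ u, c u = none ↔ u ∈ R) ∧
      ∀ u e, c u = some e → e ∈ F.edgeSet := by
  classical
  choose f g hfg using fun x (hx : x ∉ R) => exists_shorter h hx
  set c : α → Option β := fun u => if hu : u ∈ R then none else some (f u hu) with hcdef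
  have hnone : ∀ u, c u = none ↔ u ∈ R := by intro u; simp [hcdef]
  have hsome : ∀ u (hu : u ∉ R), c u = some (f u hu) := by intro u hu; simp [hcdef, hu]
  have hedge : ∀ u e, c u = some e → ∃ hu : u ∉ R, f u hu = e := by
    intro u e hu
    have hR : u ∉ R := fun h => by simp [(hnone u).2 h] at hu
    exact ⟨hR, by rwa [hsome u hR, Option.some_inj] at hu⟩
  have hpar : ∀ u (hu : u ∉ R), G.parent c u = g u hu := by
    intro u hu
    rw [parent_of_eq_some (hsome u hu)]
    exact ((hfg u hu).1.mono hFG).otherEnd_eq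
  refine ⟨c, ⟨?_, ?_⟩, hnone, ?_⟩
  · intro u e hu
    obtain ⟨hR, rfl⟩ := hedge u e hu
    refine ⟨g u hR, ?_, (hfg u hR).1.mono hFG⟩
    intro h
    have := (hfg u hR).2
    rw [h] at this
    exact lt_irrefl _ this
  · intro u
    induction hd : sInf {n | F.ReachesIn R n u} using Nat.strong_induction_on generalizing u with
    | _ d ih =>
      subst hd
      by_cases hR : u ∈ R
      · exact ⟨0, (hnone u).2 hR⟩
      · obtain ⟨k, hk⟩ := ih _ (hfg u hR).2 (g u hR) rfl
        exact ⟨k + 1, by rwa [Function.iterate_succ_apply, hpar u hR]⟩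
  · intro u e hu
    obtain ⟨hR, rfl⟩ := hedge u e hu
    exact (hfg u hR).1.edge_mem

/-- An edge between vertices with the same root closes a cycle with the parent edges. -/
lemma IsParentChoice.hasCycle_of_isLink (hc : G.IsParentChoice c) (hle : G.choiceForest c ≤ F)
    (h : F.IsLink e x y) (he : ∀ u, c u ≠ some e) (hr : G.choiceRoot c x = G.choiceRoot c y) :
    F.HasCycle := by
  set a := G.choiceDepth c x with ha
  set b := G.choiceDepth c y with hb
  set p := G.parent c with hp
  have hedge : ∀ z k, k < G.choiceDepth c z → ∃ f, c (p^[k] z) = some f := by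
    intro z k hk
    cases hz : c (p^[k] z) with
    | none => exact absurd (Nat.sInf_le (s := {k | c (p^[k] z) = none}) hz) (not_le.2 hk)
    | some f => exact ⟨f, rfl⟩
  have hstep : ∀ z k f, c (p^[k] z) = some f → F.IsLink f (p^[k] z) (p^[k + 1] z) := by
    intro z k f hf
    rw [Function.iterate_succ_apply']
    exact (hc.choiceForest_isLink hf).mono hle
  have hne : ∀ z k f f', c (p^[k] z) = some f → c (p^[k + 1] z) = some f' → f ≠ f' := by
    rintro z k f _ hf hf' rfl
    rw [Function.iterate_succ_apply'] at hf'
    exact hc.parent_ne hf (hc.eq_of_eq_some hf' hf)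
  have : Nonempty β := ⟨e⟩
  choose! fx hfx using hedge x
  choose! fy hfy using hedge y
  -- The walk descends from the root of `x` to `x` (index `a`), crosses `e` to `y` (index `a + 1`)
  -- and climbs to the root of `y`. The two paths may share vertices; only the absence of
  -- backtracking is needed.
  set V : ℕ → α := fun k => if k ≤ a then p^[a - k] x else p^[k - (a + 1)] y with hVdef
  set E : ℕ → β := fun k => if k < a then fx (a - k - 1) else if k = a then e
    else fy (k - (a + 1)) with hEdef
  refine hasCycle_of_walk (m := a + 1 + b) (v := V) (e := E) (s := 0) (t := a + 1 + b) ?_ ?_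
    (by omega) le_rfl ?_
  · intro k hk
    rcases lt_trichotomy k a with h1 | rfl | h1
    · have := hstep x (a - k - 1) _ (hfx _ (by omega))
      rw [show a - k - 1 + 1 = a - k by omega] at this
      simp only [hVdef, hEdef, if_pos h1, if_pos h1.le, if_pos (Nat.succ_le_of_lt h1)]
      rw [show a - (k + 1) = a - k - 1 by omega]
      exact this.symm
    · simp [hVdef, hEdef, h]
    · have := hstep y (k - (a + 1)) _ (hfy _ (by omega))
      simp only [hVdef, hEdef, if_neg h1.not_gt, if_neg h1.ne', if_neg h1.not_ge]
      rw [if_neg (by omega), show k + 1 - (a + 1) = k - (a + 1) + 1 by omega]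
      exact this
  · intro k hk
    simp only [hEdef]
    rcases lt_trichotomy (k + 1) a with h1 | h1 | h1
    · rw [if_pos (by omega), if_pos h1]
      have h2 := hfx (a - (k + 1) - 1) (by omega)
      have h3 := hfx (a - k - 1) (by omega)
      have h4 : a - k - 1 = a - (k + 1) - 1 + 1 := by omega
      rw [h4] at h3 ⊢
      exact (hne x _ _ _ h2 h3).symm
    · rw [if_pos (by omega), if_neg (by omega), if_pos h1]
      intro h2
      exact he _ (h2 ▸ hfx (a - k - 1) (by omega))
    · rcases Nat.lt_or_ge a k with h2 | h2
      · rw [if_neg (by omega), if_neg (by omega), if_neg (by omega), if_neg (by omega)]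
        have h3 := hfy (k - (a + 1)) (by omega)
        have h4 := hfy (k + 1 - (a + 1)) (by omega)
        have h5 : k + 1 - (a + 1) = k - (a + 1) + 1 := by omega
        rw [h5] at h4 ⊢
        exact hne y _ _ _ h3 h4
      · rw [if_neg (by omega), if_pos (by omega), if_neg (by omega), if_neg (by omega)]
        intro h3
        exact he _ (h3.symm ▸ hfy (k + 1 - (a + 1)) (by omega))
  · simp only [hVdef]
    rw [if_pos (Nat.zero_le _), if_neg (by omega), Nat.sub_zero,
      show a + 1 + b - (a + 1) = b by omega]
    exact hr

/-- First edges of shortest paths to `R` give the choice. The ends of any other edge of `F` have the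
same last ancestor, because their component has only one root; that edge would close a cycle. -/
lemma exists_choiceForest_eq (hV : G.vertexSet = Set.univ) (hF : F.IsSpanningSubgraph G)
    (hR : F.IsRootedForest R) :
    ∃ c, G.IsParentChoice c ∧ G.choiceForest c = F ∧ {u | c u = none} = R := by
  have hmem : ∀ x, x ∈ F.vertexSet := fun x => by rw [hF.vertexSet_eq, hV]; trivial
  have hreach : ∀ x, ∃ n, F.ReachesIn R n x := by
    intro x
    obtain ⟨r, ⟨hr, hrK⟩, -⟩ := hR.existsUnique_root _ (isComponent_component (hmem x))
    exact Joined.exists_reachesIn hrK hr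
  obtain ⟨c, hc, hnone, hedge⟩ := exists_isParentChoice hF.le hreach
  have hle : G.choiceForest c ≤ F := by
    have hcomp : (G.choiceForest c).Compatible F := .of_le_le restrict_le hF.le
    refine hcomp.le_iff.2 ⟨fun x _ => hmem x, ?_⟩
    rw [hc.edgeSet_choiceForest]
    rintro e ⟨u, hu⟩
    exact hedge u e hu
  have hspan : (G.choiceForest c).IsSpanningSubgraph F :=
    ⟨hle, by rw [hF.vertexSet_eq]; rfl⟩
  refine ⟨c, hc, hspan.ext_of_edgeSet (hle.edgeSet_mono.antisymm fun e he => ?_),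
    Set.ext hnone⟩
  rw [hc.edgeSet_choiceForest]
  by_contra hne
  have hne' : ∀ u, c u ≠ some e := fun u hu => hne ⟨u, hu⟩
  obtain ⟨x, y, hxy⟩ := F.exists_isLink_of_mem_edgeSet he
  refine hR.isForest (hc.hasCycle_of_isLink hle hxy hne' ?_)
  have hK := isComponent_component (hmem x)
  refine (hR.existsUnique_root _ hK).unique ⟨(hnone _).1 (hc.apply_choiceRoot x), ?_⟩
    ⟨(hnone _).1 (hc.apply_choiceRoot y), ?_⟩
  · exact (hc.joined_choiceRoot x).mono hle
  · exact Joined.trans (Relation.ReflTransGen.single hxy.adj) ((hc.joined_choiceRoot y).mono hle)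

end Existence

/-- Parent choices with root `i` for `j` correspond to spanning rooted forests with root `i` in
the tree of `j`. -/
lemma bijOn_choiceForest (hV : G.vertexSet = Set.univ) (i j : α) :
    Set.BijOn (fun c => (G.choiceForest c, {u | c u = none}))
      {c | G.IsParentChoice c ∧ c i = none ∧ ∃ k, (G.parent c)^[k] j = i}
      (G.spanningRootedForestsAt i j) := by
  refine ⟨?_, ?_, ?_⟩
  · rintro c ⟨hc, hi, hj⟩
    refine ⟨hc.mem_spanningRootedForests hV, (G.choiceForest c).component i,
      isComponent_component ?_, Relation.ReflTransGen.refl, ?_, hi⟩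
    · change i ∈ G.vertexSet
      rw [hV]; trivial
    · change (G.choiceForest c).Joined i j
      rw [hc.joined_iff, choiceRoot_of_eq_none hi, (hc.exists_iterate_eq_iff hi).1 hj]
  · rintro c ⟨hc, -⟩ c' ⟨hc', -⟩ h
    exact hc.ext_of_choiceForest hc' (congrArg Prod.fst h) (congrArg Prod.snd h)
  · rintro ⟨F, R⟩ ⟨⟨hF, hR⟩, T, hT, hiT, hjT, hi⟩
    obtain ⟨c, hc, rfl, rfl⟩ := exists_choiceForest_eq hV hF hR
    refine ⟨c, ⟨hc, hi, (hc.exists_iterate_eq_iff hi).2 ?_⟩, rfl⟩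
    have hij := hc.joined_iff.1 ((hT.mem_iff hiT).1 hjT)
    rw [← hij, choiceRoot_of_eq_none hi]

lemma IsParentChoice.weight_choiceForest [Fintype α] (hc : G.IsParentChoice c) (w : β → ℝ) :
    (G.choiceForest c).weight w = ∏ u, (c u).elim 1 w := by
  classical
  have hE : (G.choiceForest c).edgeSet =
      ((Finset.univ.image c).eraseNone : Finset β) := by
    rw [hc.edgeSet_choiceForest]; ext e; simp
  rw [weight, hE, finprod_mem_coe_finset]
  rw [← Finset.prod_subset (Finset.subset_univ {u | c u ≠ none})
    (fun u _ hu => by simp at hu; simp [hu])]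
  symm
  refine Finset.prod_bij (fun u hu => (c u).get (Option.ne_none_iff_isSome.1 (by simpa using hu)))
    ?_ ?_ ?_ ?_
  · intro u hu
    simp
  · intro u hu v hv h
    obtain ⟨e, he⟩ := Option.ne_none_iff_exists'.1 (by simpa using hu : c u ≠ none)
    obtain ⟨f, hf⟩ := Option.ne_none_iff_exists'.1 (by simpa using hv : c v ≠ none)
    simp only [he, hf, Option.get_some] at h
    exact hc.eq_of_eq_some he (h ▸ hf)
  · intro e he
    obtain ⟨u, hu⟩ : ∃ u, c u = some e := by simpa using he
    exact ⟨u, by simp [hu], by simp [hu]⟩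
  · intro u hu
    obtain ⟨e, he⟩ := Option.ne_none_iff_exists'.1 (by simpa using hu : c u ≠ none)
    simp [he]

end Graph

/-! ### Multilinear expansion of the cofactors -/

namespace Graph

open Matrix

variable {α β : Type*} {G : Graph α β}

open Classical in
/-- The edges at `u` that are not loops. -/
noncomputable def nonloopEdges (G : Graph α β) (hE : G.edgeSet.Finite) (u : α) : Finset β :=
  {e ∈ hE.toFinset | G.IsNonloopAt e u}

lemma mem_nonloopEdges (hE : G.edgeSet.Finite) {u : α} {e : β} :
    e ∈ G.nonloopEdges hE u ↔ G.IsNonloopAt e u := by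
  simp only [nonloopEdges, Finset.mem_filter, Set.Finite.mem_toFinset, and_iff_right_iff_imp]
  exact fun h => h.edge_mem

lemma totalWeight_eq_ncard {w : β → ℝ} (hw : ∀ e ∈ G.edgeSet, w e = 1)
    {S : Set (Graph α β × Set α)} (hS : S.Finite) (hG : ∀ F ∈ S, F.1 ≤ G) :
    totalWeight w S = S.ncard := by
  rw [totalWeight, Set.ncard_eq_toFinset_card S hS, finsum_mem_eq_finite_toFinset_sum _ hS,
    Finset.card_eq_sum_ones, Nat.cast_sum]
  refine Finset.sum_congr rfl fun F hF => ?_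
  rw [Nat.cast_one, weight]
  exact finprod_mem_eq_one_of_forall_eq_one fun e he =>
    hw e ((hG F (hS.mem_toFinset.1 hF)).edgeSet_mono he)

variable [DecidableEq α]

lemma linkWeight_eq_sum (hE : G.edgeSet.Finite) (w : β → ℝ) {u v : α} (h : v ≠ u) :
    G.linkWeight w u v = ∑ e ∈ G.nonloopEdges hE u with G.otherEnd u e = v, w e := by
  have : {e | G.IsLink e u v} =
      (({e ∈ G.nonloopEdges hE u | G.otherEnd u e = v} : Finset β) : Set β) := by
    ext e
    simp only [Set.mem_ofPred_eq, Finset.coe_filter, mem_nonloopEdges]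
    refine ⟨fun he => ⟨⟨v, h, he⟩, he.otherEnd_eq⟩, ?_⟩
    rintro ⟨he, rfl⟩
    exact he.isLink_otherEnd
  rw [linkWeight, this, finsum_mem_coe_finset]

variable [Fintype α]

/-- The row of `u` in the forest matrix is a sum over the possible parent edges of `u`. -/
lemma forestMatrix_row (hE : G.edgeSet.Finite) (w : β → ℝ) (u : α) :
    G.forestMatrix w u = Pi.single u 1 +
      ∑ e ∈ G.nonloopEdges hE u, w e • (Pi.single u 1 - Pi.single (G.otherEnd u e) 1) := by
  ext v
  simp only [forestMatrix, kirchhoffMatrix, Matrix.add_apply, Matrix.of_apply, Pi.add_apply,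
    Finset.sum_apply, Pi.smul_apply, Pi.sub_apply, smul_eq_mul, Matrix.one_apply]
  rcases eq_or_ne u v with rfl | h
  · simp only [if_true, Pi.single_eq_same]
    congr 1
    have h1 : ∀ e ∈ G.nonloopEdges hE u, G.otherEnd u e ∈ Finset.univ.erase u := fun e he => by
      simpa using ((mem_nonloopEdges hE).1 he).otherEnd_ne
    -- The diagonal entry is regrouped by the other end of each edge; loops at `u` contribute
    -- nothing.
    rw [Finset.sum_congr rfl fun k hk => linkWeight_eq_sum hE w (Finset.ne_of_mem_erase hk),
      Finset.sum_fiberwise_of_maps_to h1]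
    refine Finset.sum_congr rfl fun e he => ?_
    rw [Pi.single_eq_of_ne ((mem_nonloopEdges hE).1 he).otherEnd_ne.symm]
    ring
  · rw [if_neg h, if_neg h, Pi.single_eq_of_ne h.symm, linkWeight_eq_sum hE w h.symm,
      Finset.sum_filter, ← Finset.sum_neg_distrib]
    congr 1
    refine Finset.sum_congr rfl fun e _ => ?_
    by_cases he : G.otherEnd u e = v
    · simp [he]
    · simp [he]

/-- The assignments of at most one edge to each vertex, none to `i`, loops not allowed. -/
noncomputable def edgeChoices (G : Graph α β) (hE : G.edgeSet.Finite) (i : α) :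
    Finset (α → Option β) :=
  Fintype.piFinset fun u => if u = i then {none} else (G.nonloopEdges hE u).insertNone

lemma mem_edgeChoices (hE : G.edgeSet.Finite) {i : α} {c : α → Option β} :
    c ∈ G.edgeChoices hE i ↔ c i = none ∧ ∀ u e, c u = some e → G.IsNonloopAt e u := by
  simp only [edgeChoices, Fintype.mem_piFinset]
  constructor
  · intro h
    have hi : c i = none := by simpa using h i
    refine ⟨hi, fun u e hu => ?_⟩
    have hui : u ≠ i := by rintro rfl; simp [hi] at hu
    have := h u
    rw [if_neg hui, hu, Finset.some_mem_insertNone] at this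
    exact (mem_nonloopEdges hE).1 this
  · rintro ⟨hi, h⟩ u
    split_ifs with hui
    · simp [hui, hi]
    · rw [Finset.mem_insertNone]
      exact fun e he => (mem_nonloopEdges hE).2 (h u e he)

/-- Expansion of the cofactors of the forest matrix by multilinearity in the rows. -/
lemma adjugate_forestMatrix_eq_sum (hE : G.edgeSet.Finite) (w : β → ℝ) (i j : α) :
    (G.forestMatrix w).adjugate j i = ∑ c ∈ G.edgeChoices hE i,
      (∏ u, (c u).elim 1 w) * (arcMatrix (G.parent c) (fun u => c u = none)).adjugate j i := by
  -- Row `i` is overwritten by the unit vector of `j`, so the only choice there is `none`, with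
  -- factor 1; this makes `i` a root.
  set row : α → Option β → α → ℝ := fun u o =>
    if u = i then Pi.single j 1 else
      Pi.single u 1 - o.elim 0 (fun e => Pi.single (G.otherEnd u e) 1) with hrow
  have h1 : (G.forestMatrix w).updateRow i (Pi.single j 1) = fun u =>
      ∑ o ∈ (if u = i then {none} else (G.nonloopEdges hE u).insertNone),
        (o.elim 1 w) • row u o := by
    funext u
    by_cases hu : u = i
    · subst hu
      rw [Matrix.updateRow_self, if_pos rfl, Finset.sum_singleton]
      simp [hrow]
    · rw [if_neg hu, Finset.sum_insertNone, Matrix.updateRow_ne hu]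
      simp only [hrow, if_neg hu, Option.elim_none,
        Option.elim_some, one_smul, sub_zero]
      exact forestMatrix_row hE w u
  have h2 := (Matrix.detRowAlternating (n := α) (R := ℝ)).toMultilinearMap.map_sum_finset
    (fun u o => (Option.elim o 1 w) • row u o)
    (fun u => if u = i then {none} else (G.nonloopEdges hE u).insertNone)
  rw [Matrix.adjugate_apply, h1]
  refine h2.trans (Finset.sum_congr rfl fun c hc => ?_)
  rw [MultilinearMap.map_smul_univ, smul_eq_mul, Matrix.adjugate_apply]
  congr 1
  change Matrix.det _ = _
  congr 1
  ext u v
  by_cases hu : u = i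
  · subst hu
    simp [hrow, Matrix.updateRow_self]
  · rw [Matrix.updateRow_ne hu]
    simp only [hrow, if_neg hu, arcMatrix, Matrix.of_apply]
    rcases Option.eq_none_or_eq_some (c u) with h | ⟨e, h⟩
    · simp [h]
    · simp [h, parent_of_eq_some h]

/-- The cofactors of the forest matrix as sums over parent choices. -/
lemma adjugate_forestMatrix (hE : G.edgeSet.Finite) (w : β → ℝ) (i j : α) :
    (G.forestMatrix w).adjugate j i =
      ∑ᶠ c ∈ {c | G.IsParentChoice c ∧ c i = none ∧ ∃ k, (G.parent c)^[k] j = i},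
        (G.choiceForest c).weight w := by
  classical
  have hset : {c | G.IsParentChoice c ∧ c i = none ∧ ∃ k, (G.parent c)^[k] j = i} =
      (({c ∈ G.edgeChoices hE i | (∀ u, ∃ k, c ((G.parent c)^[k] u) = none) ∧
        ∃ k, (G.parent c)^[k] j = i} : Finset _) : Set (α → Option β)) := by
    ext c
    simp only [Set.mem_ofPred_eq, Finset.coe_filter, mem_edgeChoices]
    constructor
    · rintro ⟨hc, hi, hj⟩
      exact ⟨⟨hi, hc.isNonloopAt⟩, hc.exists_root, hj⟩
    · rintro ⟨⟨hi, h⟩, h', hj⟩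
      exact ⟨⟨h, h'⟩, hi, hj⟩
  rw [adjugate_forestMatrix_eq_sum hE, hset, finsum_mem_coe_finset, Finset.sum_filter]
  refine Finset.sum_congr rfl fun c hc => ?_
  obtain ⟨hi, hloop⟩ := (mem_edgeChoices hE).1 hc
  rw [adjugate_arcMatrix (G.parent c) (fun u => c u = none) j
    (fun u hu => parent_of_eq_none hu) hi]
  split_ifs with h
  · rw [mul_one, IsParentChoice.weight_choiceForest ⟨hloop, h.1⟩]
  · rw [mul_zero]

lemma finite_setOf_isParentChoice (hE : G.edgeSet.Finite) (i j : α) :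
    {c | G.IsParentChoice c ∧ c i = none ∧ ∃ k, (G.parent c)^[k] j = i}.Finite :=
  (G.edgeChoices hE i).finite_toSet.subset fun _ ⟨hc, hi, _⟩ =>
    (mem_edgeChoices hE).2 ⟨hi, hc.isNonloopAt⟩

end Graph

theorem theorem6 {β : Type*} {n : ℕ} (G : Graph (Fin (n + 1)) β)
    (hV : G.vertexSet = Set.univ) (hE : G.edgeSet.Finite) (w : β → ℝ) (i j : Fin (n + 1)) :
    (G.spanningRootedForestsAt i j).Finite ∧
    matrixCofactor (G.forestMatrix w) i j =
      Graph.totalWeight w (G.spanningRootedForestsAt i j) ∧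
    ((∀ e ∈ G.edgeSet, w e = 1) →
      matrixCofactor (G.forestMatrix w) i j = ((G.spanningRootedForestsAt i j).ncard : ℝ)) := by
  have hbij := Graph.bijOn_choiceForest hV i j
  have hfin : (G.spanningRootedForestsAt i j).Finite := by
    rw [← hbij.image_eq]
    exact (Graph.finite_setOf_isParentChoice hE i j).image _
  have hmain : matrixCofactor (G.forestMatrix w) i j =
      Graph.totalWeight w (G.spanningRootedForestsAt i j) := by
    rw [matrixCofactor_eq_adjugate, Graph.adjugate_forestMatrix hE]
    exact finsum_mem_eq_of_bijOn _ hbij fun _ _ => rfl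
  refine ⟨hfin, hmain, fun hw => hmain.trans ?_⟩
  exact Graph.totalWeight_eq_ncard hw hfin fun F hF => hF.1.1.le
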